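/- For $n\ge d+1$ let $C^d_n\subseteq S_n$ be the stabiliser, under permutation of columns, of the set of positive real $(d+1)\times n$ matrices, i.e. those all of whose maximal minors (with columns taken in increasing order) are positive. Let $d\ge 2$ be even. Let $s\in S_n$ be the order-reversing permutation $i\mapsto n+1-i$ and let $r\in S_n$ be the rotation $i\mapsto i+1$ (with $n\mapsto 1$). If $n=d+2=2m$, regard $S_m\times S_m$ as the subgroup of $S_n$ of permutations preserving the parity of positions: the first factor permutes the odd positions via $i\mapsto 2i-1$ $(1\le i\le m)$, the second permutes the even positions via $i\mapsto s(2i-1)$. Let $(S_m\times S_m)\rtimes\mathbb Z/2$ be the semidirect product in which the generator of $\mathbb Z/2$ swaps the two factors; it maps to $S_n$ by sending the generator of $\mathbb Z/2$ to $s$. Let $\phi:(S_m\times S_m)\rtimes \mathbb Z/2\to\{1,-1\}$ be the homomorphism $(\omega,\pi,\tau)\mapsto \operatorname{sgn}(\omega)\operatorname{sgn}(\pi)\gamma(\tau)$, where $\gamma$ sends the generator of $\mathbb Z/2$ to $-1$. Then: 1. If $n=d+1$, then $C^d_n=A_n$. 2. If $n=d+2=2m$ and $d/2$ is even, then the map above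 restricts to an isomorphism from $(A_n\cap(S_m\times S_m))\rtimes\mathbb Z/2$ onto $C^d_n$. 3. If $n=d+2=2m$ and $d/2$ is odd, then the map above restricts to an isomorphism from $\ker\phi$ onto $C^d_n$. 4. If $n\ge d+3$ and $d/2$ is even, then $C^d_n$ is the dihedral group $\mathbb D_n$ of order $2n$: there is an isomorphism $\mathbb D_n\to C^d_n$ sending the standard rotation to $r$ and a standard reflection to $s$. 5. If $n\ge d+3$ and $d/2$ is odd, then $C^d_n$ is cyclic of order $n$: there is an isomorphism $\mathbb Z/n\to C^d_n$ sending $1$ to $r$. -/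

import Mathlib

open Equiv

/-- A real `k × n` matrix is positive if all its maximal minors (the determinants of the square
matrices formed by `k` columns, taken in increasing order) are positive. -/
def IsPositiveMatrix {k n : ℕ} (A : Matrix (Fin k) (Fin n) ℝ) : Prop :=
  ∀ I : Fin k ↪o Fin n, 0 < (A.submatrix id I).det

/-- The matrix `A` with its columns permuted: `σ` moves the column in position `j` to
position `σ j`. -/
def permuteColumns {k n : ℕ} (σ : Perm (Fin n)) (A : Matrix (Fin k) (Fin n) ℝ) :
    Matrix (Fin k) (Fin n) ℝ :=
  A.submatrix id (σ⁻¹ : Perm (Fin n))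

theorem permuteColumns_one {k n : ℕ} (A : Matrix (Fin k) (Fin n) ℝ) :
    permuteColumns 1 A = A := rfl

theorem permuteColumns_mul {k n : ℕ} (σ τ : Perm (Fin n)) (A : Matrix (Fin k) (Fin n) ℝ) :
    permuteColumns (σ * τ) A = permuteColumns σ (permuteColumns τ A) := by
  ext i j
  simp [permuteColumns, mul_inv_rev]

/-- The group `C^d_n`: the stabiliser in `S_n` of the set of positive `(d+1) × n` matrices, under
the action of `S_n` by permutation of columns. -/
def positiveStabilizer (d n : ℕ) : Subgroup (Perm (Fin n)) where
  carrier := {σ | ∀ A : Matrix (Fin (d + 1)) (Fin n) ℝ,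
    IsPositiveMatrix (permuteColumns σ A) ↔ IsPositiveMatrix A}
  one_mem' := fun A => by rw [permuteColumns_one]
  mul_mem' := fun {σ τ} hσ hτ A => by rw [permuteColumns_mul, hσ, hτ]
  inv_mem' := fun {σ} hσ A => by
    rw [← hσ (permuteColumns σ⁻¹ A), ← permuteColumns_mul, mul_inv_cancel, permuteColumns_one]

/-- The group `ℤ/2`, written multiplicatively. -/
abbrev C2 : Type := Multiplicative (ZMod 2)

/-- The homomorphism from `ℤ/2` sending the generator to a given element `g` with `g * g = 1`. -/
def C2.lift {G : Type*} [Group G] (g : G) (hg : g * g = 1) : C2 →* G :=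
  MonoidHom.mk' (fun t => if t = 1 then 1 else g) (by
    have key : ∀ a : C2, a = 1 ∨ a = Multiplicative.ofAdd 1 := by decide
    have h1 : (Multiplicative.ofAdd 1 : C2) ≠ 1 := by decide
    have h2 : (Multiplicative.ofAdd 1 : C2) * Multiplicative.ofAdd 1 = 1 := by decide
    intro a b
    rcases key a with rfl | rfl <;> rcases key b with rfl | rfl
    · rw [if_pos (one_mul _), if_pos rfl, one_mul]
    · rw [one_mul, if_pos rfl, one_mul]
    · rw [mul_one, if_pos rfl, mul_one]
    · rw [h2, if_pos rfl, if_neg h1, hg])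

theorem C2.lift_one {G : Type*} [Group G] (g : G) (hg : g * g = 1) : C2.lift g hg 1 = 1 :=
  map_one _

theorem C2.lift_ne_one {G : Type*} [Group G] (g : G) (hg : g * g = 1) {t : C2} (ht : t ≠ 1) :
    C2.lift g hg t = g :=
  if_neg ht

/-- `ℤ/2` acts on `G × G` by swapping the two factors. -/
def swapAction (G : Type*) [Group G] : C2 →* MulAut (G × G) :=
  C2.lift (G := MulAut (G × G)) MulEquiv.prodComm (by ext x <;> rfl)

/-- The wreath product `(S_m × S_m) ⋊ ℤ/2`. -/
abbrev WreathTwo (m : ℕ) : Type :=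
  (Perm (Fin m) × Perm (Fin m)) ⋊[swapAction (Perm (Fin m))] C2

/-- The map underlying `interleave`. -/
def interleaveFun (m : ℕ) : Fin m ⊕ Fin m → Fin (2 * m) :=
  Sum.elim (fun i => ⟨2 * i, by omega⟩) (fun i => Fin.rev ⟨2 * i, by omega⟩)

theorem interleaveFun_bijective (m : ℕ) : Function.Bijective (interleaveFun m) := by
  rw [Fintype.bijective_iff_injective_and_card]
  refine ⟨?_, by simp [two_mul]⟩
  rintro (⟨i, hi⟩ | ⟨i, hi⟩) (⟨j, hj⟩ | ⟨j, hj⟩) h <;>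
    simp [interleaveFun, Fin.ext_iff, Fin.val_rev] at h ⊢ <;> omega

/-- Two copies of `{0, …, m - 1}` as the two parity classes of positions in `{0, …, 2m - 1}`: the
first copy is `i ↦ 2i`, the second is the order-reversed one, `i ↦ 2m - 1 - 2i`. -/
noncomputable def interleave (m : ℕ) : Fin m ⊕ Fin m ≃ Fin (2 * m) :=
  Equiv.ofBijective (interleaveFun m) (interleaveFun_bijective m)

theorem rev_interleave (m : ℕ) (x : Fin m ⊕ Fin m) :
    Fin.rev (interleave m x) = interleave m x.swap := by
  rcases x with i | i
  · rfl
  · exact Fin.rev_rev _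

/-- `S_m × S_m` as the group of permutations of `{0, …, 2m - 1}` preserving both parity classes. -/
noncomputable def parityHom (m : ℕ) : Perm (Fin m) × Perm (Fin m) →* Perm (Fin (2 * m)) :=
  (interleave m).permCongrHom.toMonoidHom.comp (Perm.sumCongrHom (Fin m) (Fin m))

theorem parityHom_interleave (m : ℕ) (p : Perm (Fin m) × Perm (Fin m)) (x : Fin m ⊕ Fin m) :
    parityHom m p (interleave m x) = interleave m (Sum.map p.1 p.2 x) := by
  simp [parityHom, Equiv.permCongrHom, Equiv.permCongr_apply]

theorem revPerm_mul_self (n : ℕ) : (Fin.revPerm : Perm (Fin n)) * Fin.revPerm = 1 := by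
  ext i
  simp

theorem revPerm_conj_parityHom (m : ℕ) (p : Perm (Fin m) × Perm (Fin m)) :
    parityHom m p.swap * Fin.revPerm = Fin.revPerm * parityHom m p := by
  ext j
  obtain ⟨x, rfl⟩ := (interleave m).surjective j
  simp only [Perm.mul_apply, Fin.revPerm_apply, rev_interleave, parityHom_interleave]
  rcases x with i | i <;> rfl

/-- The action of `(S_m × S_m) ⋊ ℤ/2` on `{0, …, 2m - 1}`: the two factors `S_m` permute the two
parity classes, and the generator of `ℤ/2` acts as the order-reversing permutation. -/
noncomputable def wreathHom (m : ℕ) : WreathTwo m →* Perm (Fin (2 * m)) :=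
  SemidirectProduct.lift (parityHom m) (C2.lift Fin.revPerm (revPerm_mul_self _)) (by
    intro t
    ext1 p
    change parityHom m (swapAction _ t p) = _
    by_cases ht : t = 1
    · subst ht
      simp
    · rw [swapAction, C2.lift_ne_one _ _ ht, C2.lift_ne_one _ _ ht]
      change parityHom m p.swap = Fin.revPerm * parityHom m p * Fin.revPerm⁻¹
      rw [← revPerm_conj_parityHom, mul_inv_cancel_right])

/-- The homomorphism `φ : (S_m × S_m) ⋊ ℤ/2 → {1, -1}`,
`(ω, π, τ) ↦ sgn ω * sgn π * γ τ`, where `γ` sends the generator of `ℤ/2` to `-1`. -/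
def wreathSign (m : ℕ) : WreathTwo m →* ℤˣ :=
  SemidirectProduct.lift
    (Perm.sign.comp (MonoidHom.fst _ _) * Perm.sign.comp (MonoidHom.snd _ _))
    (C2.lift (-1 : ℤˣ) (by decide)) (by
      intro t
      ext1 p
      by_cases ht : t = 1
      · subst ht
        simp
      · rw [swapAction, C2.lift_ne_one _ _ ht, C2.lift_ne_one _ _ ht]
        change Perm.sign p.2 * Perm.sign p.1 = -1 * (Perm.sign p.1 * Perm.sign p.2) * (-1)⁻¹
        rw [mul_comm (-1 : ℤˣ), mul_inv_cancel_right, mul_comm])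

/-- `A_{2m} ∩ (S_m × S_m)`, as a subgroup of `S_m × S_m`. -/
noncomputable def evenPairs (m : ℕ) : Subgroup (Perm (Fin m) × Perm (Fin m)) :=
  (alternatingGroup (Fin (2 * m))).comap (parityHom m)

theorem swap_mem_evenPairs {m : ℕ} {p : Perm (Fin m) × Perm (Fin m)} (hp : p ∈ evenPairs m) :
    p.swap ∈ evenPairs m := by
  have h := congrArg Perm.sign (revPerm_conj_parityHom m p)
  rw [map_mul, map_mul, mul_comm] at h
  rw [evenPairs, Subgroup.mem_comap, Perm.mem_alternatingGroup] at hp ⊢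
  rw [mul_left_cancel h, hp]

/-- Swapping the two components, as an automorphism of `A_{2m} ∩ (S_m × S_m)`. -/
noncomputable def evenSwap (m : ℕ) : MulAut (evenPairs m) where
  toFun p := ⟨p.1.swap, swap_mem_evenPairs p.2⟩
  invFun p := ⟨p.1.swap, swap_mem_evenPairs p.2⟩
  left_inv _ := rfl
  right_inv _ := rfl
  map_mul' _ _ := rfl

/-- The group `(A_{2m} ∩ (S_m × S_m)) ⋊ ℤ/2`, where `ℤ/2` acts by swapping the components. -/
abbrev EvenWreathTwo (m : ℕ) : Type :=
  evenPairs m ⋊[C2.lift (evenSwap m) (by ext1; rfl)] C2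

/-!
All minors of a positive matrix `A` on increasing tuples of columns are positive, so the sign of
its minor on an arbitrary injective tuple `f` depends on `f` alone: it is the sign of the
Vandermonde product `∏_{i < j} (f j - f i)` (`IsPositiveMatrix.det_mul_vandermondeProd_pos`). Points
on the moment curve give a positive matrix, hence a permutation lies in the stabiliser if and only
if it preserves the orientation of all increasing tuples (`mem_positiveStabilizer_iff`).

* If `n = d + 1`, there is one tuple, and the condition is that `σ` is even.
* If `n = d + 2`, bordering `A` by a unit row shows that `σ` multiplies the signed minor
  `(-1) ^ j * det A_j`, where `A_j` omits column `j`, by its sign and moves it to the place `σ j`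
  (`det_succAbove_perm`). The condition becomes `sgn σ * (-1) ^ (j + σ j) = 1` for all `j`: either
  `σ` is even and preserves all parities, or it is odd and changes all of them. Since the reversal
  changes all parities and has sign `(-1) ^ m`, this describes the subgroups of the wreath product.
* If `n ≥ d + 3`, let `c(x, y)` be the sign telling whether `σ` keeps the order of `x` and `y`.
  Multiplying the conditions for the four tuples which extend a common `(d - 1)`-tuple by one of
  `x`, `y` and one of `z`, `w` gives `c(x, z) c(y, z) c(x, w) c(y, w) = 1`
  (`orderAgreement_quadrilateral`). As `d` is even, rotations lie in the stabiliser, so one may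
  assume that `σ` fixes `0`. Then `c(0, y) = 1` for all `y`, and the relation makes `c` constant on
  the nonzero positions (`eq_one_or_eq_reflection`): `σ` is the identity, or it fixes `0` and
  reverses the rest, which is the rotation composed with the reversal. Finally, the reversal acts
  on `(d + 1)`-tuples with sign `(-1) ^ (d / 2)`, so it lies in the stabiliser if and only if
  `d / 2` is even.
-/

/-! ### Orientations of tuples of columns -/

/-- The Vandermonde product `∏_{i < j} (f j - f i)` of a tuple of positions. Its sign is the sign
of the minor of a positive matrix on the columns `f 0, f 1, …`, in this order. -/
noncomputable def vandermondeProd {k n : ℕ} (f : Fin k → Fin n) : ℝ :=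
  ∏ i : Fin k, ∏ j ∈ Finset.Ioi i, (((f j : ℕ) : ℝ) - ((f i : ℕ) : ℝ))

/-- The matrix whose columns are the points `(1, j, j², …)` of the moment curve. -/
def momentMatrix (k n : ℕ) : Matrix (Fin k) (Fin n) ℝ :=
  Matrix.of fun i j => ((j : ℕ) : ℝ) ^ (i : ℕ)

theorem det_momentMatrix_submatrix {k n : ℕ} (f : Fin k → Fin n) :
    ((momentMatrix k n).submatrix id f).det = vandermondeProd f := by
  rw [vandermondeProd, ← Matrix.det_vandermonde (fun i => ((f i : ℕ) : ℝ)), ← Matrix.det_transpose]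
  rfl

theorem vandermondeProd_pos_of_strictMono {k n : ℕ} {f : Fin k → Fin n} (hf : StrictMono f) :
    0 < vandermondeProd f :=
  Finset.prod_pos fun _ _ => Finset.prod_pos fun _ hj =>
    sub_pos.2 (Nat.cast_lt.2 (hf (Finset.mem_Ioi.1 hj)))

theorem isPositiveMatrix_momentMatrix (k n : ℕ) : IsPositiveMatrix (momentMatrix k n) := by
  intro I
  rw [det_momentMatrix_submatrix]
  exact vandermondeProd_pos_of_strictMono I.strictMono

theorem det_submatrix_comp_perm {k n : ℕ} (A : Matrix (Fin k) (Fin n) ℝ) (f : Fin k → Fin n)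
    (τ : Perm (Fin k)) :
    (A.submatrix id (f ∘ τ)).det = (Perm.sign τ : ℝ) * (A.submatrix id f).det :=
  Matrix.det_permute' τ (A.submatrix id f)

theorem vandermondeProd_comp_perm {k n : ℕ} (f : Fin k → Fin n) (τ : Perm (Fin k)) :
    vandermondeProd (f ∘ τ) = (Perm.sign τ : ℝ) * vandermondeProd f := by
  rw [← det_momentMatrix_submatrix, ← det_momentMatrix_submatrix, det_submatrix_comp_perm]

/-- An injective tuple is a permutation of an increasing one. -/
theorem exists_orderEmbedding_comp_perm {k n : ℕ} {f : Fin k → Fin n} (hf : f.Injective) :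
    ∃ (I : Fin k ↪o Fin n) (τ : Perm (Fin k)), f = I ∘ τ := by
  refine ⟨OrderEmbedding.ofStrictMono (f ∘ Tuple.sort f)
    ((Tuple.monotone_sort f).strictMono_of_injective (hf.comp (Tuple.sort f).injective)),
    (Tuple.sort f)⁻¹, ?_⟩
  ext i
  simp

/-- Both factors change by the sign of the permutation when the tuple is reordered, so the product
can be computed on the increasing reordering. -/
theorem IsPositiveMatrix.det_mul_vandermondeProd_pos {k n : ℕ} {A : Matrix (Fin k) (Fin n) ℝ}
    (hA : IsPositiveMatrix A) {f : Fin k → Fin n} (hf : f.Injective) :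
    0 < (A.submatrix id f).det * vandermondeProd f := by
  obtain ⟨I, τ, rfl⟩ := exists_orderEmbedding_comp_perm hf
  rw [det_submatrix_comp_perm, vandermondeProd_comp_perm]
  have h1 := mul_pos (hA I) (vandermondeProd_pos_of_strictMono I.strictMono)
  rcases Int.units_eq_one_or (Perm.sign τ) with h | h <;> simpa [h] using h1

/-- Membership in the stabiliser is a condition on orientations alone. -/
theorem mem_positiveStabilizer_iff {d n : ℕ} {σ : Perm (Fin n)} :
    σ ∈ positiveStabilizer d n ↔
      ∀ I : Fin (d + 1) ↪o Fin n, 0 < vandermondeProd ((σ⁻¹ : Perm (Fin n)) ∘ I) := by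
  constructor
  · intro h I
    have := (h (momentMatrix _ _)).2 (isPositiveMatrix_momentMatrix _ _) I
    rwa [permuteColumns, Matrix.submatrix_submatrix, Function.comp_id,
      det_momentMatrix_submatrix] at this
  · intro h
    have step : ∀ A : Matrix (Fin (d + 1)) (Fin n) ℝ, IsPositiveMatrix A →
        IsPositiveMatrix (permuteColumns σ A) := fun A hA I => by
      rw [permuteColumns, Matrix.submatrix_submatrix, Function.comp_id]
      exact pos_of_mul_pos_left (hA.det_mul_vandermondeProd_pos
        ((σ⁻¹ : Perm (Fin n)).injective.comp I.injective)) (h I).le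
    have pow : ∀ (A : Matrix (Fin (d + 1)) (Fin n) ℝ) (m : ℕ), IsPositiveMatrix A →
        IsPositiveMatrix (permuteColumns (σ ^ m) A) := fun A m hA => by
      induction m with
      | zero => rwa [pow_zero, permuteColumns_one]
      | succ m ih => rw [pow_succ', permuteColumns_mul]; exact step _ ih
    -- `σ` has finite order, so its inverse is a power of `σ` and preserves positivity as well.
    refine fun A => ⟨fun hA => ?_, step A⟩
    have := pow _ (orderOf σ - 1) hA
    rwa [← permuteColumns_mul, ← pow_succ, Nat.sub_add_cancel (orderOf_pos σ), pow_orderOf_eq_one,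
      permuteColumns_one] at this

/-- An element of the stabiliser preserves the orientation of every injective tuple. -/
theorem vandermondeProd_mul_pos_of_mem {d n : ℕ} {σ : Perm (Fin n)}
    (h : σ ∈ positiveStabilizer d n) {f : Fin (d + 1) → Fin n} (hf : f.Injective) :
    0 < vandermondeProd (σ ∘ f) * vandermondeProd f := by
  have := ((inv_mem h) (momentMatrix _ _)).2 (isPositiveMatrix_momentMatrix _ _)
  have := this.det_mul_vandermondeProd_pos hf
  rwa [permuteColumns, Matrix.submatrix_submatrix, Function.comp_id, inv_inv,
      det_momentMatrix_submatrix] at this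

/-! ### Square matrices -/

theorem positiveStabilizer_square (d : ℕ) :
    positiveStabilizer d (d + 1) = alternatingGroup (Fin (d + 1)) := by
  ext σ
  rw [mem_positiveStabilizer_iff, Perm.mem_alternatingGroup]
  have hid : ∀ I : Fin (d + 1) ↪o Fin (d + 1), (I : Fin (d + 1) → Fin (d + 1)) = id := fun I =>
    (I.strictMono.range_inj strictMono_id).1 (by
      rw [(Finite.surjective_of_injective I.injective).range_eq, Set.range_id])
  have key : vandermondeProd (σ⁻¹ : Perm (Fin (d + 1))) =
      (Perm.sign σ : ℝ) * vandermondeProd (id : Fin (d + 1) → Fin (d + 1)) := by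
    have := vandermondeProd_comp_perm id σ⁻¹
    rwa [Function.id_comp, Perm.sign_inv] at this
  have hpos := vandermondeProd_pos_of_strictMono (strictMono_id (α := Fin (d + 1)))
  constructor
  · intro h
    have h := h (RelEmbedding.refl _)
    rw [hid, Function.comp_id, key] at h
    rcases Int.units_eq_one_or (Perm.sign σ) with h1 | h1
    · exact h1
    · rw [h1] at h
      simp at h
      linarith
  · intro h I
    rw [hid, Function.comp_id, key, h]
    simpa using hpos

/-! ### Matrices with one column more than rows -/

/-- Both sides are, up to the sign of `σ`, the determinant of `A` bordered by a unit row. -/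
theorem det_succAbove_perm {k : ℕ} (A : Matrix (Fin k) (Fin (k + 1)) ℝ) (σ : Perm (Fin (k + 1)))
    (j : Fin (k + 1)) :
    (-1) ^ (σ j : ℕ) * (A.submatrix id ((σ⁻¹ : Perm _) ∘ (σ j).succAbove)).det =
      (Perm.sign σ : ℝ) * ((-1) ^ (j : ℕ) * (A.submatrix id j.succAbove).det) := by
  let M : Matrix (Fin (k + 1)) (Fin (k + 1)) ℝ :=
    Matrix.of fun i c => Fin.cases (motive := fun _ => ℝ) (Pi.single (M := fun _ => ℝ) j 1 c)
      (fun i => A i c) i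
  have hM : ∀ c, M 0 c = Pi.single (M := fun _ => ℝ) j 1 c := fun _ => rfl
  have h1 : M.det = (-1) ^ (j : ℕ) * (A.submatrix id j.succAbove).det := by
    rw [Matrix.det_succ_row_zero, Finset.sum_eq_single j]
    · rw [hM, Pi.single_eq_same, mul_one]
      rfl
    · intro b _ hb
      rw [hM, Pi.single_eq_of_ne hb, mul_zero, zero_mul]
    · simp
  have h2 : (M.submatrix id (σ⁻¹ : Perm _)).det =
      (-1) ^ (σ j : ℕ) * (A.submatrix id ((σ⁻¹ : Perm _) ∘ (σ j).succAbove)).det := by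
    rw [Matrix.det_succ_row_zero, Finset.sum_eq_single (σ j)]
    · rw [Matrix.submatrix_apply, id, hM, show σ⁻¹ (σ j) = j by simp, Pi.single_eq_same, mul_one]
      rfl
    · intro b _ hb
      have : σ⁻¹ b ≠ j := fun h => hb (by rw [← h]; simp)
      rw [Matrix.submatrix_apply, id, hM, Pi.single_eq_of_ne this, mul_zero, zero_mul]
    · simp
  rw [← h1, ← h2, Matrix.det_permute', Perm.sign_inv]

/-- The stabiliser for `n = d + 2`: signs are compared with parities of positions. -/
theorem mem_positiveStabilizer_add_two {d : ℕ} {n : ℕ} (hn : n = d + 2) {σ : Perm (Fin n)} :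
    σ ∈ positiveStabilizer d n ↔
      ∀ j : Fin n, (Perm.sign σ : ℤˣ) * ((-1) ^ (j : ℕ) * (-1) ^ (σ j : ℕ)) = 1 := by
  subst hn
  rw [mem_positiveStabilizer_iff]
  have hI : ∀ I : Fin (d + 1) ↪o Fin (d + 2),
      ∃ j : Fin (d + 2), (I : Fin (d + 1) → Fin (d + 2)) = j.succAbove := fun I => by
    have hc : (Finset.univ.image I)ᶜ.card = 1 := by
      rw [Finset.card_compl, Finset.card_image_of_injective _ I.injective]
      simp
    obtain ⟨j, hj⟩ := Finset.card_eq_one.1 hc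
    refine ⟨j, (I.strictMono.range_inj (Fin.strictMono_succAbove j)).1 ?_⟩
    rw [Fin.range_succAbove]
    have := congrArg (fun s : Finset (Fin (d + 2)) => ((sᶜ : Finset _) : Set (Fin (d + 2)))) hj
    simpa using this
  have key : ∀ j : Fin (d + 2),
      0 < vandermondeProd ((σ⁻¹ : Perm (Fin (d + 2))) ∘ (σ j).succAbove) ↔
        (Perm.sign σ : ℤˣ) * ((-1) ^ (j : ℕ) * (-1) ^ (σ j : ℕ)) = 1 := fun j => by
    have h := det_succAbove_perm (momentMatrix (d + 1) (d + 2)) σ j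
    rw [det_momentMatrix_submatrix, det_momentMatrix_submatrix] at h
    have hpos := vandermondeProd_pos_of_strictMono (Fin.strictMono_succAbove j)
    rcases Int.units_eq_one_or (Perm.sign σ) with h1 | h1 <;>
    rcases neg_one_pow_eq_or ℤˣ (j : ℕ) with h2 | h2 <;>
    rcases neg_one_pow_eq_or ℤˣ (σ j : ℕ) with h3 | h3 <;>
    · have h2' := congrArg (fun u : ℤˣ => ((u : ℤ) : ℝ)) h2
      have h3' := congrArg (fun u : ℤˣ => ((u : ℤ) : ℝ)) h3
      simp at h2' h3'
      simp [h1, h2', h3'] at h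
      simp [h1, h2, h3]
      linarith
  constructor
  · intro h j
    exact (key j).1 (h (Fin.succAboveOrderEmb (σ j)))
  · intro h I
    obtain ⟨j, hj⟩ := hI I
    rw [hj]
    obtain ⟨i, rfl⟩ := σ.surjective j
    exact (key i).2 (h i)

/-! ### The signs of the rotation and of the order reversal -/

/-- The rotation after the reversal fixes `0` and reverses the remaining positions. -/
theorem sign_revPerm_succ (n : ℕ) :
    Perm.sign (Fin.revPerm : Perm (Fin (n + 1))) =
      (-1) ^ n * Perm.sign (Fin.revPerm : Perm (Fin n)) := by
  have h : finRotate (n + 1) * Fin.revPerm = Perm.decomposeFin.symm (0, Fin.revPerm) := by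
    ext i
    refine Fin.cases ?_ (fun i => ?_) i
    · simp
    · simp [Fin.rev_succ]
  have h' := congrArg Perm.sign h
  rw [Perm.sign_mul, sign_finRotate, Perm.decomposeFin.symm_sign] at h'
  simp at h'
  rw [← h', ← mul_assoc, ← pow_add, Even.neg_one_pow ⟨n, rfl⟩, one_mul]

theorem sign_revPerm_two_mul (m : ℕ) :
    Perm.sign (Fin.revPerm : Perm (Fin (2 * m))) = (-1) ^ m := by
  induction m with
  | zero => rfl
  | succ m ih =>
    change Perm.sign (Fin.revPerm : Perm (Fin (2 * m + 1 + 1))) = _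
    rw [sign_revPerm_succ, sign_revPerm_succ, ih, pow_succ, pow_mul, pow_succ]
    simp [pow_succ]

theorem sign_revPerm_two_mul_add_one (m : ℕ) :
    Perm.sign (Fin.revPerm : Perm (Fin (2 * m + 1))) = (-1) ^ m := by
  rw [sign_revPerm_succ, sign_revPerm_two_mul, pow_mul]
  simp

/-! ### The wreath product -/

theorem sign_parityHom (m : ℕ) (p : Perm (Fin m) × Perm (Fin m)) :
    Perm.sign (parityHom m p) = Perm.sign p.1 * Perm.sign p.2 :=
  (Perm.sign_permCongr _ _).trans (Perm.sign_sumCongr _ _)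

theorem neg_one_pow_interleave_inl (m : ℕ) (i : Fin m) :
    (-1 : ℤˣ) ^ (interleave m (.inl i) : ℕ) = 1 :=
  Even.neg_one_pow ⟨i, two_mul _⟩

theorem neg_one_pow_interleave_inr (m : ℕ) (i : Fin m) :
    (-1 : ℤˣ) ^ (interleave m (.inr i) : ℕ) = -1 := by
  refine Odd.neg_one_pow ⟨m - 1 - i, ?_⟩
  change (Fin.rev (⟨2 * i, by omega⟩ : Fin (2 * m)) : ℕ) = _
  rw [Fin.val_rev]
  simp only
  omega

theorem neg_one_pow_rev {m : ℕ} (j : Fin (2 * m)) :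
    (-1 : ℤˣ) ^ (Fin.rev j : ℕ) = -(-1) ^ (j : ℕ) := by
  obtain ⟨x, rfl⟩ := (interleave m).surjective j
  rw [rev_interleave]
  rcases x with i | i <;>
    simp [neg_one_pow_interleave_inl, neg_one_pow_interleave_inr]

theorem neg_one_pow_parityHom {m : ℕ} (p : Perm (Fin m) × Perm (Fin m)) (j : Fin (2 * m)) :
    (-1 : ℤˣ) ^ (parityHom m p j : ℕ) = (-1) ^ (j : ℕ) := by
  obtain ⟨x, rfl⟩ := (interleave m).surjective j
  rw [parityHom_interleave]
  rcases x with i | i <;>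
    simp [neg_one_pow_interleave_inl, neg_one_pow_interleave_inr]

theorem parityHom_injective (m : ℕ) : Function.Injective (parityHom m) :=
  (interleave m).permCongrHom.injective.comp Perm.sumCongrHom_injective

/-- A permutation preserving the parity of every position permutes the two parity classes. -/
theorem exists_parityHom_eq {m : ℕ} {σ : Perm (Fin (2 * m))}
    (h : ∀ j, (-1 : ℤˣ) ^ (σ j : ℕ) = (-1) ^ (j : ℕ)) : ∃ p, parityHom m p = σ := by
  have hmem : (interleave m).permCongrHom.symm σ ∈
      (Perm.sumCongrHom (Fin m) (Fin m)).range := by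
    refine Perm.mem_sumCongrHom_range_of_perm_mapsTo_inl ?_
    rintro _ ⟨i, rfl⟩
    change (interleave m).symm (σ (interleave m (.inl i))) ∈ _
    have hi := h (interleave m (.inl i))
    obtain ⟨y, hy⟩ := (interleave m).surjective (σ (interleave m (.inl i)))
    rw [← hy, neg_one_pow_interleave_inl] at hi
    rw [← hy, symm_apply_apply]
    rcases y with y | y
    · exact ⟨y, rfl⟩
    · rw [neg_one_pow_interleave_inr] at hi
      exact absurd hi (by decide)
  obtain ⟨p, hp⟩ := hmem
  exact ⟨p, (congrArg (interleave m).permCongrHom hp).trans (MulEquiv.apply_symm_apply _ σ)⟩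

theorem wreathHom_one (m : ℕ) (p : Perm (Fin m) × Perm (Fin m)) :
    wreathHom m ⟨p, 1⟩ = parityHom m p := by
  change parityHom m p * C2.lift _ _ 1 = _
  rw [C2.lift_one, mul_one]

theorem wreathHom_ne_one (m : ℕ) (p : Perm (Fin m) × Perm (Fin m)) {t : C2} (ht : t ≠ 1) :
    wreathHom m ⟨p, t⟩ = parityHom m p * Fin.revPerm := by
  change parityHom m p * C2.lift _ _ t = _
  rw [C2.lift_ne_one _ _ ht]

theorem C2.eq_of_ne_one {s t : C2} (hs : s ≠ 1) (ht : t ≠ 1) : s = t := by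
  revert s t
  decide

/-- The sign `γ(t)` by which `wreathHom` changes parities determines the component in `ℤ/2`. -/
theorem wreathHom_injective {m : ℕ} (hm : 0 < m) : Function.Injective (wreathHom m) := by
  have key : ∀ (p q : Perm (Fin m) × Perm (Fin m)) (t : C2), t ≠ 1 →
      wreathHom m ⟨p, 1⟩ ≠ wreathHom m ⟨q, t⟩ := fun p q t ht h => by
    rw [wreathHom_one, wreathHom_ne_one _ _ ht] at h
    have h0 := congrArg (fun j : Fin (2 * m) => (-1 : ℤˣ) ^ (j : ℕ))
      (Perm.congr_fun h ⟨0, by omega⟩)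
    simp only [Perm.mul_apply, neg_one_pow_parityHom, Fin.revPerm_apply, neg_one_pow_rev] at h0
    exact absurd h0 (by decide)
  rintro ⟨p, s⟩ ⟨q, t⟩ h
  by_cases hs : s = 1 <;> by_cases ht : t = 1
  · subst hs ht
    rw [wreathHom_one, wreathHom_one] at h
    rw [parityHom_injective m h]
  · subst hs
    exact absurd h (key p q t ht)
  · subst ht
    exact absurd h.symm (key q p s hs)
  · rw [wreathHom_ne_one _ _ hs, wreathHom_ne_one _ _ ht] at h
    rw [parityHom_injective m (mul_right_cancel h), C2.eq_of_ne_one hs ht]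

theorem exists_wreathHom_eq {d m : ℕ} (hm : 2 * m = d + 2) {σ : Perm (Fin (2 * m))}
    (hσ : σ ∈ positiveStabilizer d (2 * m)) : ∃ w, wreathHom m w = σ := by
  rw [mem_positiveStabilizer_add_two hm] at hσ
  rcases Int.units_eq_one_or (Perm.sign σ) with hs | hs
  · obtain ⟨p, hp⟩ := exists_parityHom_eq (σ := σ) fun j => by
      have h := hσ j
      rw [hs, one_mul] at h
      rw [← Int.units_inv_eq_self ((-1 : ℤˣ) ^ (j : ℕ))]
      exact eq_inv_of_mul_eq_one_right h
    exact ⟨⟨p, 1⟩, by rw [wreathHom_one, hp]⟩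
  · obtain ⟨p, hp⟩ := exists_parityHom_eq (σ := σ * Fin.revPerm) fun j => by
      have h := hσ (Fin.rev j)
      rw [hs, neg_one_pow_rev, neg_mul, one_mul, neg_mul, neg_neg] at h
      rw [← Int.units_inv_eq_self ((-1 : ℤˣ) ^ (j : ℕ))]
      exact eq_inv_of_mul_eq_one_right h
    refine ⟨⟨p, Multiplicative.ofAdd 1⟩, ?_⟩
    rw [wreathHom_ne_one _ _ (by decide), hp, mul_assoc, revPerm_mul_self, mul_one]

theorem wreathHom_one_mem_iff {d m : ℕ} (hm : 2 * m = d + 2) {p : Perm (Fin m) × Perm (Fin m)} :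
    wreathHom m ⟨p, 1⟩ ∈ positiveStabilizer d (2 * m) ↔ Perm.sign p.1 * Perm.sign p.2 = 1 := by
  rw [mem_positiveStabilizer_add_two hm, wreathHom_one, sign_parityHom]
  have : Nonempty (Fin (2 * m)) := ⟨⟨0, by omega⟩⟩
  simp only [neg_one_pow_parityHom, Int.units_mul_self, mul_one, forall_const]

theorem wreathHom_ne_one_mem_iff {d m : ℕ} (hm : 2 * m = d + 2)
    {p : Perm (Fin m) × Perm (Fin m)} {t : C2} (ht : t ≠ 1) :
    wreathHom m ⟨p, t⟩ ∈ positiveStabilizer d (2 * m) ↔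
      Perm.sign p.1 * Perm.sign p.2 * (-1) ^ (m + 1) = 1 := by
  rw [mem_positiveStabilizer_add_two hm, wreathHom_ne_one _ _ ht, Perm.sign_mul, sign_parityHom,
    sign_revPerm_two_mul, pow_succ]
  have : Nonempty (Fin (2 * m)) := ⟨⟨0, by omega⟩⟩
  simp only [Perm.mul_apply, Fin.revPerm_apply, neg_one_pow_parityHom, neg_one_pow_rev, mul_neg,
    Int.units_mul_self, mul_one, forall_const]

theorem wreathSign_one (m : ℕ) (p : Perm (Fin m) × Perm (Fin m)) :
    wreathSign m ⟨p, 1⟩ = Perm.sign p.1 * Perm.sign p.2 := by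
  change Perm.sign p.1 * Perm.sign p.2 * C2.lift _ _ 1 = _
  rw [C2.lift_one, mul_one]

theorem wreathSign_ne_one (m : ℕ) (p : Perm (Fin m) × Perm (Fin m)) {t : C2} (ht : t ≠ 1) :
    wreathSign m ⟨p, t⟩ = Perm.sign p.1 * Perm.sign p.2 * -1 := by
  change Perm.sign p.1 * Perm.sign p.2 * C2.lift _ _ t = _
  rw [C2.lift_ne_one _ _ ht]

theorem mem_evenPairs_iff {m : ℕ} {p : Perm (Fin m) × Perm (Fin m)} :
    p ∈ evenPairs m ↔ Perm.sign p.1 * Perm.sign p.2 = 1 := by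
  rw [evenPairs, Subgroup.mem_comap, Perm.mem_alternatingGroup, sign_parityHom]

theorem wreathHom_mem_iff_mem_evenPairs {d m : ℕ} (hm : 2 * m = d + 2) (h : Even (d / 2))
    (w : WreathTwo m) : wreathHom m w ∈ positiveStabilizer d (2 * m) ↔ w.left ∈ evenPairs m := by
  obtain ⟨p, t⟩ := w
  rw [mem_evenPairs_iff]
  by_cases ht : t = 1
  · subst ht
    exact wreathHom_one_mem_iff hm
  · have hodd : Even (m + 1) := by
      rw [show m + 1 = d / 2 + 2 by omega]
      exact h.add even_two
    rw [wreathHom_ne_one_mem_iff hm ht, hodd.neg_one_pow, mul_one]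

theorem wreathHom_mem_iff_mem_ker {d m : ℕ} (hm : 2 * m = d + 2) (h : Odd (d / 2))
    (w : WreathTwo m) :
    wreathHom m w ∈ positiveStabilizer d (2 * m) ↔ w ∈ (wreathSign m).ker := by
  obtain ⟨p, t⟩ := w
  rw [MonoidHom.mem_ker]
  by_cases ht : t = 1
  · subst ht
    rw [wreathHom_one_mem_iff hm, wreathSign_one]
  · have hodd : Odd (m + 1) := by
      rw [show m + 1 = d / 2 + 2 by omega]
      exact h.add_even even_two
    rw [wreathHom_ne_one_mem_iff hm ht, hodd.neg_one_pow, wreathSign_ne_one m p ht]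

/-- The inclusion of `(A_{2m} ∩ (S_m × S_m)) ⋊ ℤ/2` into `(S_m × S_m) ⋊ ℤ/2`. -/
noncomputable def evenWreathInclusion (m : ℕ) : EvenWreathTwo m →* WreathTwo m :=
  SemidirectProduct.map (evenPairs m).subtype (MonoidHom.id C2) (by
    intro t
    ext1 p
    by_cases ht : t = 1
    · subst ht
      simp
    · change ((C2.lift (evenSwap m) _ t p : evenPairs m) : Perm (Fin m) × Perm (Fin m)) =
        swapAction _ t p
      rw [swapAction, C2.lift_ne_one _ _ ht, C2.lift_ne_one _ _ ht]
      rfl)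

theorem exists_mulEquiv_of_even {d m : ℕ} (hm : 2 * m = d + 2) (h : Even (d / 2)) :
    ∃ e : EvenWreathTwo m ≃* positiveStabilizer d (2 * m),
      ∀ w : EvenWreathTwo m,
        (e w : Perm (Fin (2 * m))) = wreathHom m ⟨(w.left : _ × _), w.right⟩ := by
  let f : EvenWreathTwo m →* positiveStabilizer d (2 * m) :=
    ((wreathHom m).comp (evenWreathInclusion m)).codRestrict _ fun w =>
      (wreathHom_mem_iff_mem_evenPairs hm h _).2 w.left.2
  refine ⟨MulEquiv.ofBijective f ⟨fun v w hvw => ?_, fun σ => ?_⟩, fun w => rfl⟩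
  · have := wreathHom_injective (by omega) (congrArg Subtype.val hvw)
    have hl : (v.left : Perm (Fin m) × Perm (Fin m)) = w.left :=
      congrArg (fun x : WreathTwo m => x.left) this
    have hr : v.right = w.right :=
      congrArg (fun x : WreathTwo m => x.right) this
    exact SemidirectProduct.ext (Subtype.ext hl) hr
  · obtain ⟨w, hw⟩ := exists_wreathHom_eq hm σ.2
    exact ⟨⟨⟨w.left, (wreathHom_mem_iff_mem_evenPairs hm h w).1 (hw ▸ σ.2)⟩, w.right⟩,
      Subtype.ext hw⟩

theorem exists_mulEquiv_of_odd {d m : ℕ} (hm : 2 * m = d + 2) (h : Odd (d / 2)) :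
    ∃ e : (wreathSign m).ker ≃* positiveStabilizer d (2 * m),
      ∀ w : (wreathSign m).ker,
        (e w : Perm (Fin (2 * m))) = wreathHom m (w : WreathTwo m) := by
  let f : (wreathSign m).ker →* positiveStabilizer d (2 * m) :=
    ((wreathHom m).comp (wreathSign m).ker.subtype).codRestrict _ fun w =>
      (wreathHom_mem_iff_mem_ker hm h _).2 w.2
  refine ⟨MulEquiv.ofBijective f ⟨fun v w hvw => ?_, fun σ => ?_⟩, fun w => rfl⟩
  · exact Subtype.ext (wreathHom_injective (by omega) (congrArg Subtype.val hvw))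
  · obtain ⟨w, hw⟩ := exists_wreathHom_eq hm σ.2
    exact ⟨⟨w, (wreathHom_mem_iff_mem_ker hm h w).1 (hw ▸ σ.2)⟩, Subtype.ext hw⟩

/-! ### Many columns -/

/-- Comparison of the orders of two positions before and after `σ`: positive if `σ` keeps their
order, negative if it inverts it. -/
def orderAgreement {n : ℕ} (σ : Perm (Fin n)) (x y : Fin n) : ℝ :=
  (((σ x : ℕ) : ℝ) - ((σ y : ℕ) : ℝ)) * (((x : ℕ) : ℝ) - ((y : ℕ) : ℝ))

theorem orderAgreement_comm {n : ℕ} (σ : Perm (Fin n)) (x y : Fin n) :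
    orderAgreement σ x y = orderAgreement σ y x := by
  unfold orderAgreement
  ring

theorem orderAgreement_ne_zero {n : ℕ} (σ : Perm (Fin n)) {x y : Fin n} (h : x ≠ y) :
    orderAgreement σ x y ≠ 0 := by
  refine mul_ne_zero (sub_ne_zero.2 ?_) (sub_ne_zero.2 ?_)
  · exact fun e => h (σ.injective (Fin.ext (Nat.cast_injective e)))
  · exact fun e => h (Fin.ext (Nat.cast_injective e))

theorem orderAgreement_pos_iff {n : ℕ} (σ : Perm (Fin n)) {x y : Fin n} (h : x < y) :
    0 < orderAgreement σ x y ↔ σ x < σ y := by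
  have h' : ((x : ℕ) : ℝ) < ((y : ℕ) : ℝ) := Nat.cast_lt.2 h
  rw [orderAgreement, mul_pos_iff]
  constructor
  · rintro (h1 | h1)
    · linarith [h1.2]
    · exact Fin.lt_def.2 (Nat.cast_lt.1 (sub_neg.1 h1.1))
  · intro h1
    have h1' : ((σ x : ℕ) : ℝ) < ((σ y : ℕ) : ℝ) := Nat.cast_lt.2 h1
    exact Or.inr ⟨sub_neg.2 h1', sub_neg.2 h'⟩

theorem vandermondeProd_mul_eq_prod {k n : ℕ} (σ : Perm (Fin n)) (f : Fin k → Fin n) :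
    vandermondeProd (σ ∘ f) * vandermondeProd f =
      ∏ i : Fin k, ∏ j ∈ Finset.Ioi i, orderAgreement σ (f j) (f i) := by
  simp only [vandermondeProd, orderAgreement, Finset.prod_mul_distrib, Function.comp_apply]

theorem prod_orderAgreement_cons_cons {k n : ℕ} (σ : Perm (Fin n)) (x z : Fin n)
    (t : Fin k → Fin n) :
    ∏ i, ∏ j ∈ Finset.Ioi i, orderAgreement σ
        ((Fin.cons x (Fin.cons z t : Fin (k + 1) → Fin n) : Fin (k + 2) → Fin n) j)
        ((Fin.cons x (Fin.cons z t : Fin (k + 1) → Fin n) : Fin (k + 2) → Fin n) i) =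
      orderAgreement σ z x * (∏ i, orderAgreement σ (t i) x) *
        ((∏ i, orderAgreement σ (t i) z) *
          ∏ i, ∏ j ∈ Finset.Ioi i, orderAgreement σ (t j) (t i)) := by
  simp [Fin.prod_univ_succ, Fin.prod_Ioi_succ]

/-- In the product of the orientation conditions for the four tuples `(x, z, t)`, `(y, z, t)`,
`(x, w, t)`, `(y, w, t)`, everything but four factors occurs squared or to the fourth power. The
tuple `t` exists because there are at least two columns more than rows. -/
theorem orderAgreement_quadrilateral {d n : ℕ} (hd0 : 0 < d) (hn : d + 3 ≤ n) {σ : Perm (Fin n)}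
    (hσ : σ ∈ positiveStabilizer d n) {x y z w : Fin n} (hxz : x ≠ z) (hxw : x ≠ w) (hyz : y ≠ z)
    (hyw : y ≠ w) :
    0 < orderAgreement σ z x * orderAgreement σ z y *
      (orderAgreement σ w x * orderAgreement σ w y) := by
  obtain ⟨k, rfl⟩ : ∃ k, d = k + 1 := ⟨d - 1, by omega⟩
  let s : Finset (Fin n) := {x, y, z, w}
  have hs : s.card ≤ 4 := Finset.card_le_four
  obtain ⟨t⟩ : Nonempty (Fin k ↪ {a // a ∈ sᶜ}) := by
    refine Function.Embedding.nonempty_of_card_le ?_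
    rw [Fintype.card_fin, Fintype.card_coe, Finset.card_compl, Fintype.card_fin]
    omega
  have ht : ∀ i, (t i : Fin n) ≠ x ∧ (t i : Fin n) ≠ y ∧ (t i : Fin n) ≠ z ∧ (t i : Fin n) ≠ w :=
    fun i => by simpa [s] using (t i).2
  have key : ∀ a b : Fin n, a ≠ b → (∀ i, (t i : Fin n) ≠ a) → (∀ i, (t i : Fin n) ≠ b) →
      0 < orderAgreement σ b a * (∏ i, orderAgreement σ (t i) a) *
        ((∏ i, orderAgreement σ (t i) b) *
          ∏ i, ∏ j ∈ Finset.Ioi i, orderAgreement σ (t j) (t i)) := fun a b hab ha hb => by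
    have hinj : Function.Injective
        (Fin.cons a (Fin.cons b (fun i => (t i : Fin n)) : Fin (k + 1) → Fin n) :
          Fin (k + 2) → Fin n) := by
      rw [Fin.cons_injective_iff, Fin.cons_injective_iff]
      refine ⟨?_, ?_, Subtype.val_injective.comp t.injective⟩
      · rintro ⟨i, hi⟩
        revert hi
        refine Fin.cases (fun hi => hab hi.symm) (fun i hi => ha i hi) i
      · rintro ⟨i, hi⟩
        exact hb i hi
    have := vandermondeProd_mul_pos_of_mem hσ hinj
    rwa [vandermondeProd_mul_eq_prod, prod_orderAgreement_cons_cons] at this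
  have h1 := key x z hxz (fun i => (ht i).1) (fun i => (ht i).2.2.1)
  have h2 := key y z hyz (fun i => (ht i).2.1) (fun i => (ht i).2.2.1)
  have h3 := key x w hxw (fun i => (ht i).1) (fun i => (ht i).2.2.2)
  have h4 := key y w hyw (fun i => (ht i).2.1) (fun i => (ht i).2.2.2)
  have h := mul_pos (mul_pos h1 h2) (mul_pos h3 h4)
  generalize (∏ i, orderAgreement σ (t i) x) = X at h
  generalize (∏ i, orderAgreement σ (t i) y) = Y at h
  generalize (∏ i, orderAgreement σ (t i) z) = Z at h
  generalize (∏ i, orderAgreement σ (t i) w) = W at h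
  generalize (∏ i, ∏ j ∈ Finset.Ioi i, orderAgreement σ (t j : Fin n) (t i)) = T at h
  refine pos_of_mul_pos_left (b := (X * Y * Z * W * T ^ 2) ^ 2) ?_ (sq_nonneg _)
  refine h.trans_eq ?_
  ring

/-- Moving an entry of a `(d + 1)`-tuple from one end to the other is an even permutation. -/
theorem finRotate_mem_positiveStabilizer {d n : ℕ} (hd : Even d) :
    finRotate n ∈ positiveStabilizer d n := by
  rw [mem_positiveStabilizer_iff]
  intro I
  obtain ⟨N, rfl⟩ : ∃ N, n = N + 1 := ⟨n - 1, by have := (I 0).pos; omega⟩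
  change 0 < vandermondeProd ((finRotate (N + 1)).symm ∘ I)
  have hlt : ∀ {a b : Fin (N + 1)}, a ≠ 0 → a < b →
      (finRotate (N + 1)).symm a < (finRotate (N + 1)).symm b := fun {a b} ha hab => by
    have hb : b ≠ 0 := (Fin.pos_of_ne_zero ha |>.trans hab).ne'
    rw [Fin.lt_def, coe_finRotate_symm_of_ne_zero ha, coe_finRotate_symm_of_ne_zero hb]
    have := Fin.pos_of_ne_zero ha
    rw [Fin.lt_def] at this hab
    simp at this
    omega
  by_cases h0 : I 0 = 0
  · -- The first chosen column moves to the end: the rotation of the tuple, which is an even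
    -- permutation of its `d + 1` entries, makes the tuple increasing.
    have hne : ∀ i : Fin (d + 1), i ≠ 0 → I i ≠ 0 := fun i hi h =>
      hi (I.injective (h.trans h0.symm))
    have hmono : StrictMono (((finRotate (N + 1)).symm ∘ I) ∘ finRotate (d + 1)) := by
      intro i j hij
      have hi : i ≠ Fin.last d := (hij.trans_le (Fin.le_last j)).ne
      have hi1 : finRotate (d + 1) i ≠ 0 := fun h => by
        have := coe_finRotate_of_ne_last hi
        rw [h] at this
        simp at this
      by_cases hj : j = Fin.last d
      · subst hj
        have hlast : (finRotate (N + 1)).symm 0 = Fin.last N := by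
          rw [symm_apply_eq, finRotate_last]
        simp only [Function.comp_apply]
        rw [finRotate_last, h0, hlast]
        refine lt_of_le_of_ne (Fin.le_last _) fun h => hne _ hi1 ?_
        rw [← hlast] at h
        exact (finRotate (N + 1)).symm.injective h
      · refine hlt (hne _ hi1) (I.strictMono ?_)
        rw [Fin.lt_def, coe_finRotate_of_ne_last hi, coe_finRotate_of_ne_last hj]
        simpa using hij
    have := vandermondeProd_pos_of_strictMono hmono
    rwa [vandermondeProd_comp_perm, sign_finRotate, Nat.add_sub_cancel, hd.neg_one_pow,
      Units.val_one, Int.cast_one, one_mul] at this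
  · exact vandermondeProd_pos_of_strictMono fun i j hij =>
      hlt (fun h => h0 (le_antisymm (h ▸ I.monotone (Fin.zero_le i)) (Fin.zero_le _)))
        (I.strictMono hij)

theorem revPerm_mem_positiveStabilizer_iff {d n : ℕ} (hd : Even d) (hn : d + 1 ≤ n) :
    (Fin.revPerm : Perm (Fin n)) ∈ positiveStabilizer d n ↔ Even (d / 2) := by
  have hsign : Perm.sign (Fin.revPerm : Perm (Fin (d + 1))) = (-1) ^ (d / 2) := by
    obtain ⟨e, rfl⟩ := even_iff_exists_two_mul.1 hd
    rw [sign_revPerm_two_mul_add_one, Nat.mul_div_cancel_left _ two_pos]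
  have key : ∀ I : Fin (d + 1) ↪o Fin n,
      0 < vandermondeProd (((Fin.revPerm : Perm (Fin n))⁻¹ : Perm (Fin n)) ∘ I) ↔
        Even (d / 2) := fun I => by
    have hmono : StrictMono ((((Fin.revPerm : Perm (Fin n))⁻¹ : Perm (Fin n)) ∘ I) ∘
        (Fin.revPerm : Perm (Fin (d + 1)))) := fun i j hij =>
      Fin.rev_lt_rev.2 (I.strictMono (Fin.rev_lt_rev.2 hij))
    have h := vandermondeProd_pos_of_strictMono hmono
    rw [vandermondeProd_comp_perm, hsign] at h
    rcases Nat.even_or_odd (d / 2) with he | ho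
    · rw [he.neg_one_pow] at h
      simpa [he] using h
    · rw [ho.neg_one_pow] at h
      simp at h
      simp [Nat.not_even_iff_odd.2 ho]
      exact h.le
  rw [mem_positiveStabilizer_iff]
  exact ⟨fun h => (key (Fin.castLEOrderEmb hn)).1 (h _), fun h I => (key I).2 h⟩

theorem perm_eq_one_of_strictMono {n : ℕ} {σ : Perm (Fin n)} (h : StrictMono σ) : σ = 1 :=
  Equiv.ext (congrFun ((h.range_inj strictMono_id).1 (by
    rw [σ.surjective.range_eq, Set.range_id])))

/-- A permutation fixing `0` and inverting no pair of nonzero positions is increasing. -/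
theorem perm_eq_one_of_orderAgreement_pos {n : ℕ} {σ : Perm (Fin (n + 1))} (h0 : σ 0 = 0)
    (h : ∀ x y, x ≠ 0 → y ≠ 0 → x ≠ y → 0 < orderAgreement σ x y) : σ = 1 := by
  refine perm_eq_one_of_strictMono fun x y hxy => ?_
  have hy : y ≠ 0 := ((Fin.zero_le x).trans_lt hxy).ne'
  by_cases hx : x = 0
  · rw [hx, h0]
    exact Fin.pos_of_ne_zero fun e => hy (σ.injective (e.trans h0.symm))
  · exact (orderAgreement_pos_iff σ hxy).1 (h x y hx hy hxy.ne)

/-- If `0` is fixed, the quadrilateral condition at `0` makes the orientation of the nonzero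
positions constant. -/
theorem eq_one_or_eq_reflection {d n : ℕ} (hd0 : 0 < d) (hn : d + 3 ≤ n + 1)
    {σ : Perm (Fin (n + 1))} (hσ : σ ∈ positiveStabilizer d (n + 1)) (h0 : σ 0 = 0) :
    σ = 1 ∨ finRotate (n + 1) * Fin.revPerm * σ = 1 := by
  have hpos0 : ∀ y : Fin (n + 1), y ≠ 0 → 0 < orderAgreement σ y 0 := fun y hy => by
    rw [orderAgreement_comm, orderAgreement_pos_iff σ (Fin.pos_of_ne_zero hy), h0]
    exact Fin.pos_of_ne_zero fun e => hy (σ.injective (e.trans h0.symm))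
  have hadj : ∀ x y z : Fin (n + 1), x ≠ 0 → y ≠ 0 → z ≠ 0 → x ≠ y → x ≠ z →
      0 < orderAgreement σ x y → 0 < orderAgreement σ x z := fun x y z hx hy hz hxy hxz h => by
    have hq := orderAgreement_quadrilateral hd0 hn hσ hy.symm hz.symm hxy hxz
    rw [orderAgreement_comm σ y x, orderAgreement_comm σ z x,
      mul_pos_iff_of_pos_left (mul_pos (hpos0 y hy) h),
      mul_pos_iff_of_pos_left (hpos0 z hz)] at hq
    exact hq
  have hall : ∀ x y z w : Fin (n + 1), x ≠ 0 → y ≠ 0 → z ≠ 0 → w ≠ 0 → x ≠ y → z ≠ w →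
      0 < orderAgreement σ x y → 0 < orderAgreement σ z w := fun x y z w hx hy hz hw hxy hzw h => by
    by_cases hxz : x = z
    · subst hxz
      exact hadj x y w hx hy hw hxy hzw h
    · have h1 := hadj x y z hx hy hz hxy hxz h
      rw [orderAgreement_comm] at h1
      exact hadj z x w hz hx hw (Ne.symm hxz) hzw h1
  by_cases hp : ∀ x y, x ≠ 0 → y ≠ 0 → x ≠ y → 0 < orderAgreement σ x y
  · exact Or.inl (perm_eq_one_of_orderAgreement_pos h0 hp)
  · push Not at hp
    obtain ⟨z, w, hz, hw, hzw, hneg⟩ := hp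
    refine Or.inr (perm_eq_one_of_orderAgreement_pos ?_ fun x y hx hy hxy => ?_)
    · rw [Perm.mul_apply, Perm.mul_apply, h0, Fin.revPerm_apply, Fin.rev_zero, finRotate_last]
    · have hlt : orderAgreement σ x y < 0 := lt_of_le_of_ne
        (not_lt.1 fun h => hneg.not_gt (hall x y z w hx hy hz hw hxy hzw h))
        (orderAgreement_ne_zero σ hxy)
      have hval : ∀ x : Fin (n + 1), x ≠ 0 →
          ((((finRotate (n + 1) * Fin.revPerm * σ : Perm (Fin (n + 1))) x : Fin (n + 1)) : ℕ) : ℝ) =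
            n + 1 - ((σ x : ℕ) : ℝ) :=
        fun x hx => by
          have hσx : σ x ≠ 0 := fun e => hx (σ.injective (e.trans h0.symm))
          have hle : (σ x : ℕ) ≤ n := Fin.le_last _
          have hne : Fin.rev (σ x) ≠ Fin.last n := fun e => hσx (by
            rw [← Fin.rev_rev (σ x), e, Fin.rev_last])
          have hrev : n + 1 - ((σ x : ℕ) + 1) + 1 = n + 1 - (σ x : ℕ) := by omega
          rw [Perm.mul_apply, Perm.mul_apply, Fin.revPerm_apply, coe_finRotate_of_ne_last hne,
            Fin.val_rev, hrev, Nat.cast_sub (by omega), Nat.cast_add_one]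
      have : orderAgreement (finRotate (n + 1) * Fin.revPerm * σ) x y = -orderAgreement σ x y := by
        rw [orderAgreement, hval x hx, hval y hy, orderAgreement]
        ring
      rw [this]
      exact neg_pos.2 hlt

/-! ### Cyclic and dihedral groups -/

theorem finRotate_mul_revPerm_mul_finRotate (n : ℕ) :
    finRotate n * Fin.revPerm * finRotate n = Fin.revPerm := by
  refine Equiv.ext fun i => ?_
  obtain ⟨N, rfl⟩ : ∃ N, n = N + 1 := ⟨n - 1, by have := i.pos; omega⟩
  simp only [Perm.mul_apply, Fin.revPerm_apply]
  by_cases hi : i = Fin.last N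
  · rw [hi, finRotate_last, Fin.rev_zero, finRotate_last, Fin.rev_last]
  · have h1 := coe_finRotate_of_ne_last hi
    have hlt := Fin.val_lt_last hi
    have h2 : Fin.rev (finRotate (N + 1) i) ≠ Fin.last N := fun e => by
      have := congrArg Fin.val e
      rw [Fin.val_rev, h1, Fin.val_last] at this
      omega
    refine Fin.ext ?_
    rw [coe_finRotate_of_ne_last h2, Fin.val_rev, Fin.val_rev, h1]
    omega

theorem finRotate_pow_apply {n : ℕ} (k i : Fin (n + 1)) :
    (finRotate (n + 1) ^ (k : ℕ)) i = i + k := by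
  rw [← Perm.iterate_eq_pow, ← finCycle_eq_finRotate_iterate, finCycle_apply]

/-- After composing with a rotation one may assume that `0` is fixed. -/
theorem exists_eq_zpow_or_eq_zpow_mul_revPerm {d n : ℕ} (hd : Even d) (hd0 : 0 < d)
    (hn : d + 3 ≤ n) {σ : Perm (Fin n)} (hσ : σ ∈ positiveStabilizer d n) :
    ∃ i : ℤ, σ = finRotate n ^ i ∨ σ = finRotate n ^ i * Fin.revPerm := by
  obtain ⟨N, rfl⟩ : ∃ N, n = N + 1 := ⟨n - 1, by omega⟩
  let k : Fin (N + 1) := -σ 0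
  have h0 : (finRotate (N + 1) ^ (k : ℕ) * σ) 0 = 0 := by
    rw [Perm.mul_apply, finRotate_pow_apply, add_neg_cancel]
  have hmem := mul_mem (pow_mem (finRotate_mem_positiveStabilizer hd) (k : ℕ)) hσ
  rcases eq_one_or_eq_reflection hd0 hn hmem h0 with h | h
  · refine ⟨-(k : ℕ), Or.inl ?_⟩
    rw [zpow_neg, zpow_natCast]
    exact eq_inv_of_mul_eq_one_right h
  · refine ⟨-(k : ℕ) + 1, Or.inr ?_⟩
    have hinv : (finRotate (N + 1) * Fin.revPerm) * (finRotate (N + 1) * Fin.revPerm) = 1 := by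
      rw [← mul_assoc, finRotate_mul_revPerm_mul_finRotate, revPerm_mul_self]
    rw [zpow_add, zpow_one, zpow_neg, zpow_natCast, mul_assoc, eq_inv_mul_iff_mul_eq]
    exact mul_left_cancel (h.trans hinv.symm)

theorem orderOf_finRotate {n : ℕ} (hn : 2 ≤ n) : orderOf (finRotate n) = n := by
  rw [← Perm.lcm_cycleType, cycleType_finRotate_of_le hn]
  simp

theorem revPerm_notMem_zpowers_finRotate {n : ℕ} (hn : 3 ≤ n) (i : ℤ) :
    finRotate n ^ i ≠ Fin.revPerm := fun h => by
  -- A power of the rotation commutes with it, whereas the reversal inverts it.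
  have h1 := finRotate_mul_revPerm_mul_finRotate n
  rw [← h, mul_assoc, (Commute.zpow_self (finRotate n) i).eq, ← mul_assoc] at h1
  have h2 : finRotate n ^ 2 = 1 := by
    rw [pow_two]
    exact mul_eq_right.1 h1
  have h3 := orderOf_dvd_of_pow_eq_one h2
  rw [orderOf_finRotate (by omega)] at h3
  have := Nat.le_of_dvd two_pos h3
  omega

theorem exists_mulEquiv_zmod {d n : ℕ} (hd : Even d) (hd0 : 0 < d) (hn : d + 3 ≤ n)
    (h : Odd (d / 2)) :
    ∃ e : Multiplicative (ZMod n) ≃* positiveStabilizer d n,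
      (e (Multiplicative.ofAdd 1) : Perm (Fin n)) = finRotate n := by
  let g : positiveStabilizer d n := ⟨finRotate n, finRotate_mem_positiveStabilizer hd⟩
  have hg : ∀ x, x ∈ Subgroup.zpowers g := by
    rintro ⟨σ, hσ⟩
    obtain ⟨i, hi | hi⟩ := exists_eq_zpow_or_eq_zpow_mul_revPerm hd hd0 hn hσ
    · exact ⟨i, Subtype.ext (by simp [g, hi])⟩
    · rw [hi, Subgroup.mul_mem_cancel_left _ (zpow_mem (finRotate_mem_positiveStabilizer hd) i),
        revPerm_mem_positiveStabilizer_iff hd (by omega)] at hσ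
      exact absurd hσ (Nat.not_even_iff_odd.2 h)
  have hcard : Nat.card (positiveStabilizer d n) = n := by
    rw [← orderOf_eq_card_of_forall_mem_zpowers hg, Subgroup.orderOf_mk,
      orderOf_finRotate (by omega)]
  exact ⟨zmodMulEquivOfGenerator hg hcard, by rw [zmodMulEquivOfGenerator_apply_ofAdd_one]⟩

/-- The homomorphism from the dihedral group sending `r 1` to `a` and `sr 0` to `b`, where
`a ^ n = 1`, `b * b = 1` and `a * b * a = b`. -/
def dihedralLift {G : Type*} [Group G] {n : ℕ} (a b : G) (ha : a ^ n = 1) (hb : b * b = 1)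
    (hab : a * b * a = b) : DihedralGroup n →* G :=
  let z : ZMod n →+ Additive G := ZMod.lift n ⟨zmultiplesHom (Additive G) (Additive.ofMul a), by
    simp [← ofMul_pow, ha]⟩
  have hz : ∀ i, (z i).toMul * b = b * (z (-i)).toMul := fun i => by
    obtain ⟨i, rfl⟩ := ZMod.intCast_surjective i
    have hs : SemiconjBy b a⁻¹ a := by
      rw [SemiconjBy, mul_inv_eq_iff_eq_mul, hab]
    rw [← Int.cast_neg]
    simpa [z] using (hs.zpow_right i).eq.symm
  MonoidHom.mk' (fun
    | .r i => (z i).toMul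
    | .sr i => b * (z i).toMul) (by
    rintro (i | i) (j | j)
    · simp
    · simp only [DihedralGroup.r_mul_sr]
      rw [← mul_assoc, hz, mul_assoc, ← toMul_add, ← map_add, neg_add_eq_sub]
    · simp only [DihedralGroup.sr_mul_r]
      rw [mul_assoc, ← toMul_add, ← map_add]
    · simp only [DihedralGroup.sr_mul_sr]
      rw [mul_assoc, ← mul_assoc _ b, hz, mul_assoc, ← mul_assoc b b, hb, one_mul, ← toMul_add,
        ← map_add, neg_add_eq_sub])

section dihedralLift

variable {G : Type*} [Group G] {n : ℕ} {a b : G} {ha : a ^ n = 1} {hb : b * b = 1}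
  {hab : a * b * a = b}

theorem dihedralLift_r (i : ℤ) : dihedralLift a b ha hb hab (.r (i : ZMod n)) = a ^ i := by
  simp [dihedralLift]

theorem dihedralLift_sr (i : ℤ) : dihedralLift a b ha hb hab (.sr (i : ZMod n)) = b * a ^ i := by
  simp [dihedralLift]

end dihedralLift

theorem exists_mulEquiv_dihedralGroup {d n : ℕ} (hd : Even d) (hd0 : 0 < d) (hn : d + 3 ≤ n)
    (h : Even (d / 2)) :
    ∃ e : DihedralGroup n ≃* positiveStabilizer d n,
      (e (DihedralGroup.r 1) : Perm (Fin n)) = finRotate n ∧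
      (e (DihedralGroup.sr 0) : Perm (Fin n)) = Fin.revPerm := by
  have hr := finRotate_mem_positiveStabilizer (n := n) hd
  have hs := (revPerm_mem_positiveStabilizer_iff hd (n := n) (by omega)).2 h
  have hrn : finRotate n ^ n = 1 := by
    have := pow_orderOf_eq_one (finRotate n)
    rwa [orderOf_finRotate (by omega)] at this
  let f : DihedralGroup n →* Perm (Fin n) := dihedralLift (finRotate n) Fin.revPerm hrn
    (revPerm_mul_self n) (finRotate_mul_revPerm_mul_finRotate n)
  have hfr : ∀ i : ℤ, f (.r i) = finRotate n ^ i := dihedralLift_r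
  have hfs : ∀ i : ℤ, f (.sr i) = Fin.revPerm * finRotate n ^ i := dihedralLift_sr
  have hmem : ∀ x, f x ∈ positiveStabilizer d n := by
    rintro (i | i) <;> obtain ⟨i, rfl⟩ := ZMod.intCast_surjective i
    · rw [hfr]
      exact zpow_mem hr i
    · rw [hfs]
      exact mul_mem hs (zpow_mem hr i)
  have hinj : Function.Injective f := by
    rw [injective_iff_map_eq_one]
    rintro (i | i) hi <;> obtain ⟨i, rfl⟩ := ZMod.intCast_surjective i
    · rw [hfr, ← orderOf_dvd_iff_zpow_eq_one, orderOf_finRotate (by omega)] at hi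
      rw [(ZMod.intCast_zmod_eq_zero_iff_dvd i n).2 hi, DihedralGroup.r_zero]
    · rw [hfs] at hi
      refine absurd ?_ (revPerm_notMem_zpowers_finRotate (n := n) (by omega) i)
      rw [eq_inv_of_mul_eq_one_right hi, inv_eq_iff_mul_eq_one, revPerm_mul_self]
  refine ⟨MulEquiv.ofBijective (f.codRestrict _ hmem)
    ⟨fun x y hxy => hinj (congrArg Subtype.val hxy), ?_⟩, ?_, ?_⟩
  · rintro ⟨σ, hσ⟩
    obtain ⟨i, hi | hi⟩ := exists_eq_zpow_or_eq_zpow_mul_revPerm hd hd0 hn hσ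
    · exact ⟨.r i, Subtype.ext ((hfr i).trans hi.symm)⟩
    · refine ⟨.r i * .sr (0 : ℤ), Subtype.ext ?_⟩
      change f _ = _
      rw [map_mul, hfr, hfs, zpow_zero, mul_one]
      exact hi.symm
  · change f _ = _
    simpa using hfr 1
  · change f _ = _
    simpa using hfs 0

theorem mainTheorem3 (d n : ℕ) (hd : Even d) (hd0 : 0 < d) :
    (n = d + 1 → positiveStabilizer d n = alternatingGroup (Fin n)) ∧
    (∀ m : ℕ, 2 * m = d + 2 → Even (d / 2) →
      ∃ e : EvenWreathTwo m ≃* positiveStabilizer d (2 * m),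
        ∀ w : EvenWreathTwo m,
          (e w : Equiv.Perm (Fin (2 * m))) = wreathHom m ⟨(w.left : _ × _), w.right⟩) ∧
    (∀ m : ℕ, 2 * m = d + 2 → Odd (d / 2) →
      ∃ e : (wreathSign m).ker ≃* positiveStabilizer d (2 * m),
        ∀ w : (wreathSign m).ker,
          (e w : Equiv.Perm (Fin (2 * m))) = wreathHom m (w : WreathTwo m)) ∧
    (d + 3 ≤ n → Even (d / 2) →
      ∃ e : DihedralGroup n ≃* positiveStabilizer d n,
        (e (DihedralGroup.r 1) : Equiv.Perm (Fin n)) = finRotate n ∧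
        (e (DihedralGroup.sr 0) : Equiv.Perm (Fin n)) = Fin.revPerm) ∧
    (d + 3 ≤ n → Odd (d / 2) →
      ∃ e : Multiplicative (ZMod n) ≃* positiveStabilizer d n,
        (e (Multiplicative.ofAdd 1) : Equiv.Perm (Fin n)) = finRotate n) := by
  refine ⟨?_, fun m hm h => exists_mulEquiv_of_even hm h, fun m hm h => exists_mulEquiv_of_odd hm h,
    fun hn h => exists_mulEquiv_dihedralGroup hd hd0 hn h,
    fun hn h => exists_mulEquiv_zmod hd hd0 hn h⟩
  rintro rfl
  exact positiveStabilizer_square d
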